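/- For $n\ge 0$ and a permutation $\pi$ of $\{1,\dots,n\}$ let $$\operatorname{altdes}(\pi)=\bigl|\{\,1\le i\le n-1: i \text{ even},\ \pi(i)<\pi(i+1)\,\}\cup\{\,1\le i\le n-1: i\text{ odd},\ \pi(i)>\pi(i+1)\,\}\bigr|,$$ and let $A^{*}_n(q)=\sum_{\pi\in\mathcal S_n}q^{\operatorname{altdes}(\pi)}$ be the alternating Eulerian polynomials. For a sequence $f=\{f_i(q)\}_{i\ge0}$ of polynomials with real coefficients let $\mathcal L f$ be the sequence $\{f_{i-1}(q)f_{i+1}(q)-f_i(q)^2\}_{i\ge1}$ (reindexed from $0$ before $\mathcal L$ is applied again), and call $f$ $k$-$q$-log-convex if for every $0\le m\le k$ all terms of $\mathcal L^m f$ have only nonnegative coefficients. Then: (i) As formal power series in $x$ over $\mathbb R[q]$, $$\sum_{n=0}^{\infty}A^{*}_{n+1}(q)\,x^n=\cfrac{1}{1-g_0x-\cfrac{h_1x^2}{1-g_1x-\cfrac{h_2x^2}{1-g_2x-\cdots}}},$$ where $g_i=(i+1)(q+1)$ for $i\ge0$ and $h_i=(q^2+1)\,i(i+1)/2$ for $i\ge1$;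 that is, the finite continued fractions ending in the denominator $1-g_nx$ converge coefficientwise (in $x$) to the left-hand side as $n\to\infty$. (ii) The sequence $\{A^{*}_{n+1}(q)\}_{n\ge0}$ is $2$-$q$-log-convex. -/

import Mathlib

open Polynomial

/-- The number of alternating descents of a permutation `π` of `{1, …, n}`: the number of positions
`i` with `1 ≤ i ≤ n - 1` such that either `i` is even and `π(i) < π(i + 1)`, or `i` is odd and
`π(i) > π(i + 1)`. The position `i` is written `j + 1` with `j : Fin n` (so that the entries
`π(i)`, `π(i + 1)` are the values at the 0-based places `j`, `j + 1`). -/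
def altDes {n : ℕ} (π : Equiv.Perm (Fin n)) : ℕ :=
  Finset.card (Finset.univ.filter fun j : Fin n =>
    ∃ hj : (j : ℕ) + 1 < n,
      (Even ((j : ℕ) + 1) ∧ π j < π ⟨(j : ℕ) + 1, hj⟩) ∨
        (Odd ((j : ℕ) + 1) ∧ π ⟨(j : ℕ) + 1, hj⟩ < π j))

/-- The alternating Eulerian polynomial `A*_n(q) = ∑_{π ∈ S_n} q ^ altdes(π)`, as a polynomial
with real coefficients in the variable `q = X`. -/
noncomputable def altEulerian (n : ℕ) : ℝ[X] :=
  ∑ π : Equiv.Perm (Fin n), (X : ℝ[X]) ^ altDes π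

section ContinuedFraction

variable {R : Type*} [CommRing R]

/-- The finite Jacobi continued fraction of depth `n` starting at level `i`,
`1/(1 - g_i x - h_{i+1} x²/(1 - g_{i+1} x - ⋯ - h_{i+n} x²/(1 - g_{i+n} x)))`,
as a formal power series in `x`. Every denominator has constant coefficient `1`
(see `constantCoeff_jacobiDenom` below), so `PowerSeries.invOfUnit _ 1` is its true inverse. -/
noncomputable def jacobiConvergent (g h : ℕ → R) : ℕ → ℕ → PowerSeries R
  | 0, i => PowerSeries.invOfUnit (1 - PowerSeries.C (g i) * PowerSeries.X) 1
  | n + 1, i => PowerSeries.invOfUnit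
      (1 - PowerSeries.C (g i) * PowerSeries.X
        - PowerSeries.C (h (i + 1)) * PowerSeries.X ^ 2 * jacobiConvergent g h n (i + 1)) 1

theorem constantCoeff_jacobiDenom (a b : R) (φ : PowerSeries R) :
    PowerSeries.constantCoeff
      (1 - PowerSeries.C a * PowerSeries.X - PowerSeries.C b * PowerSeries.X ^ 2 * φ) = 1 := by
  simp

theorem jacobiConvergent_zero_mul (g h : ℕ → R) (i : ℕ) :
    (1 - PowerSeries.C (g i) * PowerSeries.X) * jacobiConvergent g h 0 i = 1 := by
  rw [jacobiConvergent]
  exact PowerSeries.mul_invOfUnit _ _ (by simp)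

theorem jacobiConvergent_succ_mul (g h : ℕ → R) (n i : ℕ) :
    (1 - PowerSeries.C (g i) * PowerSeries.X
      - PowerSeries.C (h (i + 1)) * PowerSeries.X ^ 2 * jacobiConvergent g h n (i + 1))
      * jacobiConvergent g h (n + 1) i = 1 := by
  rw [jacobiConvergent]
  exact PowerSeries.mul_invOfUnit _ _ (by simp)

/-- `F` is the infinite Jacobi continued fraction
`1/(1 - g_0 x - h_1 x²/(1 - g_1 x - h_2 x²/(1 - g_2 x - ⋯)))`: the finite continued fractions
converge to `F` as formal power series in `x`, i.e. each coefficient is eventually that of `F`. -/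
def HasJacobiFraction (F : PowerSeries R) (g h : ℕ → R) : Prop :=
  ∀ m : ℕ, ∀ᶠ n in Filter.atTop,
    PowerSeries.coeff m (jacobiConvergent g h n 0) = PowerSeries.coeff m F

end ContinuedFraction

/-- The operator `L` sending `(f_i)_{i ≥ 0}` to `(f_{i-1} f_{i+1} - f_i²)_{i ≥ 1}`; the result is
reindexed to start at `0`. -/
noncomputable def logConvexOp (f : ℕ → ℝ[X]) : ℕ → ℝ[X] :=
  fun i => f i * f (i + 2) - f (i + 1) ^ 2

/-- `k`-`q`-log-convexity: for every `m ≤ k`, all coefficients of all members of the sequence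
`L^m (f)` are nonnegative. -/
def IsQLogConvexOrder (k : ℕ) (f : ℕ → ℝ[X]) : Prop :=
  ∀ m ≤ k, ∀ i j : ℕ, 0 ≤ ((logConvexOp^[m] f) i).coeff j

/-!
Cut a permutation at its largest entry. Whether the steps into and out of that entry are alternating
descents depends only on the parity of its position and on the convention for the first position,
and reversing the values exchanges the two conventions. Averaging the two recurrences removes the
parity, so that `F = ∑_{n ≥ 1} A*_n xⁿ / n!` solves `2 F' = (1 + F)² + (1 + q F)²`. Such a
Riccati equation `F' = 1 + a F + b F²` is tridiagonal in the series `F^k F' / k!`: the coefficients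
of these series form the Stieltjes table with `g_k = (k + 1) a` and `h_k = k (k + 1) b`, whose
column `0` is the Jacobi continued fraction.

Column `0` also consists of the corner entries of the powers of the Jacobi matrix `J`, so its Hankel
matrix factors through rows and columns of powers of `J`, and by Cauchy–Binet it inherits from `J`
the nonnegativity of all minors of order at most `3`. For `J` that nonnegativity reduces to
`a² - 2 b = 2 q`. Finally `L f` and `L² f` are given by Hankel minors of order `2` and `3`.
-/

section Arrangements

variable {γ δ : Type*}

/-- The arrangements of a finite set in a row, as lists; those of `Finset.univ : Finset (Fin n)`
are the one-line notations of the permutations of `Fin n`. -/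
def arrangements (s : Finset γ) : Finset (List γ) :=
  ⟨Multiset.lists s.val, Multiset.lists_nodup_finset s⟩

theorem mem_arrangements {s : Finset γ} {l : List γ} :
    l ∈ arrangements s ↔ s.val = (l : Multiset γ) :=
  Multiset.mem_lists_iff _ _

theorem mem_of_mem_arrangements {s : Finset γ} {l : List γ} (h : l ∈ arrangements s) {x : γ} :
    x ∈ l ↔ x ∈ s := by
  rw [← Finset.mem_val, mem_arrangements.1 h, Multiset.mem_coe]

theorem length_of_mem_arrangements {s : Finset γ} {l : List γ} (h : l ∈ arrangements s) :
    l.length = s.card := by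
  rw [Finset.card_def, mem_arrangements.1 h, Multiset.coe_card]

theorem arrangements_map (f : γ ↪ δ) (s : Finset γ) :
    arrangements (s.map f) =
      (arrangements s).map ⟨List.map f, List.map_injective_iff.2 f.injective⟩ := by
  ext l
  simp only [Finset.mem_map, Function.Embedding.coeFn_mk]
  constructor
  · intro hl
    obtain ⟨l, rfl⟩ : l ∈ Set.range (List.map f) := by
      rw [Set.range_list_map]
      intro x hx
      obtain ⟨y, -, rfl⟩ := Finset.mem_map.1 ((mem_of_mem_arrangements hl).1 hx)
      exact ⟨y, rfl⟩
    rw [mem_arrangements, Finset.map_val, ← Multiset.map_coe] at hl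
    exact ⟨l, mem_arrangements.2 (Multiset.map_injective f.injective hl), rfl⟩
  · rintro ⟨l, hl, rfl⟩
    rw [mem_arrangements, Finset.map_val, mem_arrangements.1 hl, Multiset.map_coe]

theorem append_cons_mem_arrangements_insert [DecidableEq γ] {m : γ} {t : Finset γ} (hm : m ∉ t)
    {l₁ l₂ : List γ} : l₁ ++ m :: l₂ ∈ arrangements (insert m t) ↔
      ∃ T ⊆ t, l₁ ∈ arrangements T ∧ l₂ ∈ arrangements (t \ T) := by
  simp only [mem_arrangements, Finset.insert_val_of_notMem hm, ← Multiset.coe_add,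
    ← Multiset.cons_coe, Multiset.add_cons, Multiset.cons_inj_right, Finset.sdiff_val]
  constructor
  · intro h
    have hle : (l₁ : Multiset γ) ≤ t.val := h ▸ Multiset.le_add_right _ _
    exact ⟨⟨l₁, Multiset.nodup_of_le hle t.nodup⟩, Finset.val_le_iff.1 hle, rfl,
      (congrArg (· - (l₁ : Multiset γ)) h).trans (add_tsub_cancel_left _ _)⟩
  · rintro ⟨T, hT, h₁, h₂⟩
    rw [← h₁, ← h₂, add_tsub_cancel_of_le (Finset.val_le_iff.2 hT)]

theorem sum_arrangements_insert [DecidableEq γ] {A : Type*} [AddCommMonoid A] {m : γ}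
    {t : Finset γ} (hm : m ∉ t) (φ : List γ → A) :
    ∑ l ∈ arrangements (insert m t), φ l = ∑ T ∈ t.powerset, ∑ l₁ ∈ arrangements T,
      ∑ l₂ ∈ arrangements (t \ T), φ (l₁ ++ m :: l₂) := by
  simp_rw [Finset.sum_sigma']
  symm
  refine Finset.sum_bij (fun p _ => p.2.1 ++ m :: p.2.2) ?_ ?_ ?_ fun _ _ => rfl
  · rintro ⟨T, l₁, l₂⟩ h
    simp only [Finset.mem_sigma, Finset.mem_powerset] at h
    exact (append_cons_mem_arrangements_insert hm).2 ⟨T, h⟩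
  · rintro ⟨T, l₁, l₂⟩ h ⟨T', l₁', l₂'⟩ h' heq
    simp only [Finset.mem_sigma, Finset.mem_powerset] at h h' heq
    have hm₁ : m ∉ l₁ := fun hx => hm (h.1 ((mem_of_mem_arrangements h.2.1).1 hx))
    have hm₂ : m ∉ l₂ := fun hx => hm (Finset.sdiff_subset ((mem_of_mem_arrangements h.2.2).1 hx))
    obtain ⟨rfl, -, rfl⟩ := (List.append_cons_inj_of_notMem hm₁ hm₂).1 heq
    obtain rfl : T = T' := Finset.val_injective <|
      (mem_arrangements.1 h.2.1).trans (mem_arrangements.1 h'.2.1).symm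
    rfl
  · intro l hl
    obtain ⟨l₁, l₂, rfl⟩ := List.append_of_mem
      ((mem_of_mem_arrangements hl).2 (Finset.mem_insert_self m t))
    obtain ⟨T, h⟩ := (append_cons_mem_arrangements_insert hm).1 hl
    exact ⟨⟨T, l₁, l₂⟩, by simpa using h, rfl⟩

theorem sum_arrangements_univ {A : Type*} [AddCommMonoid A] {n : ℕ} (φ : List (Fin n) → A) :
    ∑ l ∈ arrangements Finset.univ, φ l = ∑ π : Equiv.Perm (Fin n), φ (List.ofFn π) := by
  symm
  refine Finset.sum_bij (fun π _ => List.ofFn π) ?_ ?_ ?_ fun _ _ => rfl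
  · intro π _
    rw [mem_arrangements, ← Finset.map_univ_equiv π, Finset.map_val, Fin.univ_val_map]
    rfl
  · intro π _ σ _ h
    exact Equiv.coe_fn_injective (List.ofFn_injective h)
  · intro l hl
    have hlength : l.length = n := by simpa using length_of_mem_arrangements hl
    have hnodup : l.Nodup := by
      rw [← Multiset.coe_nodup, ← mem_arrangements.1 hl]
      exact Finset.nodup _
    have hinj : Function.Injective fun i : Fin n => l.get (i.cast hlength.symm) :=
      (List.nodup_iff_injective_get.1 hnodup).comp (Fin.cast_injective _)
    exact ⟨Equiv.ofBijective _ (Finite.injective_iff_bijective.1 hinj), Finset.mem_univ _,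
      List.ext_get (by simp [hlength]) (by simp)⟩

end Arrangements

section ListAltDes

variable {γ δ : Type*} [LinearOrder γ] [LinearOrder δ]

/-- Alternating descents of a list, with either convention for the first place: `listAltDes false`
counts descents at the first, third, … places and ascents at the second, fourth, … places, and
`listAltDes true` the other way round. Both are needed since a suffix of a list may start at a
place of either parity. -/
def listAltDes : Bool → List γ → ℕ
  | _, [] => 0
  | _, [_] => 0
  | b, x :: y :: l => (if (b = true ∧ x < y) ∨ (b = false ∧ y < x) then 1 else 0)
      + listAltDes (!b) (y :: l)

theorem listAltDes_map_strictMono {f : γ → δ} (hf : StrictMono f) (b : Bool) :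
    ∀ l : List γ, listAltDes b (l.map f) = listAltDes b l
  | [] | [_] => rfl
  | x :: y :: l => by
    have ih := listAltDes_map_strictMono hf (!b) (y :: l)
    simp only [List.map_cons] at ih
    simp only [List.map_cons, listAltDes, ih, hf.lt_iff_lt]

theorem listAltDes_map_strictAnti {f : γ → δ} (hf : StrictAnti f) (b : Bool) :
    ∀ l : List γ, listAltDes b (l.map f) = listAltDes (!b) l
  | [] | [_] => rfl
  | x :: y :: l => by
    have ih := listAltDes_map_strictAnti hf (!b) (y :: l)
    simp only [List.map_cons] at ih
    simp only [List.map_cons, listAltDes, ih, hf.lt_iff_gt]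
    cases b <;> simp

theorem listAltDes_cons_of_forall_lt {b : Bool} {m : γ} {l : List γ} (h : ∀ x ∈ l, x < m) :
    listAltDes b (m :: l) = (if b = false ∧ l ≠ [] then 1 else 0) + listAltDes (!b) l := by
  cases l with
  | nil => simp [listAltDes]
  | cons y l =>
    have hy : y < m := h y List.mem_cons_self
    simp [listAltDes, hy, hy.not_gt]

theorem listAltDes_append_cons {b : Bool} {m : γ} {l₁ l₂ : List γ} (h₁ : ∀ x ∈ l₁, x < m)
    (h₂ : ∀ x ∈ l₂, x < m) :
    listAltDes b (l₁ ++ m :: l₂) = listAltDes b l₁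
      + (if b = l₁.length.bodd then (if l₁ ≠ [] then 1 else 0) + (if l₂ ≠ [] then 1 else 0) else 0)
      + listAltDes (b == l₁.length.bodd) l₂ := by
  induction l₁ generalizing b with
  | nil =>
    rw [List.nil_append, listAltDes_cons_of_forall_lt h₂]
    cases b <;> simp [listAltDes]
  | cons x l₁ ih =>
    have hx : x < m := h₁ x List.mem_cons_self
    cases l₁ with
    | nil =>
      simp only [List.cons_append, List.nil_append, listAltDes, listAltDes_cons_of_forall_lt h₂]
      cases b <;> simp [hx, hx.not_gt, add_assoc]
    | cons y l₁ =>
      have ih := @ih (!b) fun z hz => h₁ z (List.mem_cons_of_mem x hz)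
      have hbodd : (x :: y :: l₁).length.bodd = !(y :: l₁).length.bodd := by simp
      rw [List.cons_append] at ih
      rw [List.cons_append, List.cons_append, listAltDes, ih, listAltDes, hbodd]
      cases b <;> cases (y :: l₁).length.bodd <;> simp [add_assoc]

theorem listAltDes_ofFn {n : ℕ} (b : Bool) (f : Fin n → γ) :
    listAltDes b (List.ofFn f) = Finset.card (Finset.univ.filter fun j : Fin n =>
      ∃ hj : (j : ℕ) + 1 < n, (Nat.bodd j ≠ b ∧ f j < f ⟨(j : ℕ) + 1, hj⟩) ∨
        (Nat.bodd j = b ∧ f ⟨(j : ℕ) + 1, hj⟩ < f j)) := by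
  induction n generalizing b with
  | zero => simp [listAltDes]
  | succ n ih =>
    cases n with
    | zero =>
      rw [List.ofFn_succ, List.ofFn_zero, listAltDes, eq_comm, Finset.card_eq_zero,
        Finset.filter_eq_empty_iff]
      rintro j - ⟨hj, -⟩
      omega
    | succ n =>
      have ih := ih (!b) fun i => f i.succ
      rw [List.ofFn_succ] at ih
      rw [List.ofFn_succ, List.ofFn_succ, listAltDes, ih, Finset.card_filter, Finset.card_filter,
        Fin.sum_univ_succ (n := n + 1)]
      congr 1
      · refine if_congr ?_ rfl rfl
        cases b <;> simp
      · refine Finset.sum_congr rfl fun j _ => if_congr ?_ rfl rfl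
        simp only [Fin.val_succ, Nat.bodd_succ, Nat.add_lt_add_iff_right, ne_eq,
          Bool.not_eq_eq_eq_not, Fin.succ_mk]

end ListAltDes

section AltSum

variable {γ : Type*} [LinearOrder γ]

/-- The generating polynomial of alternating descents of the arrangements of a finite set. -/
noncomputable def altSum (b : Bool) (s : Finset γ) : ℝ[X] :=
  ∑ l ∈ arrangements s, (X : ℝ[X]) ^ listAltDes b l

/-- The weight of the step between a largest entry and the `k` entries on one side of it, if that
step counts as an alternating descent. -/
noncomputable def stepWeight (k : ℕ) : ℝ[X] := if k = 0 then 1 else X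

theorem altSum_insert (b : Bool) {m : γ} {t : Finset γ} (hm : ∀ x ∈ t, x < m) :
    altSum b (insert m t) = ∑ T ∈ t.powerset,
      (if b = T.card.bodd then stepWeight T.card * stepWeight (t \ T).card else 1)
        * (altSum b T * altSum (b == T.card.bodd) (t \ T)) := by
  rw [altSum, sum_arrangements_insert fun h => lt_irrefl _ (hm m h)]
  refine Finset.sum_congr rfl fun T hT => ?_
  rw [altSum, altSum, Finset.sum_mul_sum, Finset.mul_sum]
  refine Finset.sum_congr rfl fun l₁ h₁ => ?_
  rw [Finset.mul_sum]
  refine Finset.sum_congr rfl fun l₂ h₂ => ?_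
  have hm₁ (x) (hx : x ∈ l₁) : x < m :=
    hm x (Finset.mem_powerset.1 hT ((mem_of_mem_arrangements h₁).1 hx))
  have hm₂ (x) (hx : x ∈ l₂) : x < m :=
    hm x (Finset.sdiff_subset ((mem_of_mem_arrangements h₂).1 hx))
  rw [listAltDes_append_cons hm₁ hm₂, pow_add, pow_add, ← length_of_mem_arrangements h₁,
    ← length_of_mem_arrangements h₂]
  simp only [stepWeight, ne_eq, List.length_eq_zero_iff]
  split_ifs <;> ring

theorem altSum_map {δ : Type*} [LinearOrder δ] (b : Bool) (f : γ ↪o δ) (s : Finset γ) :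
    altSum b (s.map f.toEmbedding) = altSum b s := by
  rw [altSum, arrangements_map, Finset.sum_map]
  exact Finset.sum_congr rfl fun l _ => congrArg _ (listAltDes_map_strictMono f.strictMono b l)

theorem altSum_univ_fin_not (b : Bool) (n : ℕ) :
    altSum (!b) (Finset.univ : Finset (Fin n)) = altSum b (Finset.univ : Finset (Fin n)) := by
  rw [altSum, altSum]
  conv_rhs => rw [← Finset.map_univ_equiv (Fin.revPerm (n := n)), arrangements_map, Finset.sum_map]
  exact Finset.sum_congr rfl fun l _ =>
    congrArg _ (listAltDes_map_strictAnti Fin.rev_strictAnti b l).symm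

theorem altDes_eq_listAltDes {n : ℕ} (π : Equiv.Perm (Fin n)) :
    altDes π = listAltDes false (List.ofFn π) := by
  rw [listAltDes_ofFn, altDes]
  congr 1
  refine Finset.filter_congr fun j _ => exists_congr fun hj => ?_
  rw [← Nat.not_even_iff_odd, Nat.even_add_one, not_not, Nat.even_iff, Nat.mod_two_of_bodd]
  cases Nat.bodd (j : ℕ) <;> simp

theorem altSum_eq_altEulerian (b : Bool) (s : Finset γ) : altSum b s = altEulerian s.card := by
  have hfalse : altSum false (Finset.univ : Finset (Fin s.card)) = altEulerian s.card := by
    simp only [altSum, sum_arrangements_univ, altEulerian, altDes_eq_listAltDes]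
  rw [← s.map_orderEmbOfFin_univ rfl, altSum_map, Finset.card_map, Finset.card_fin, ← hfalse]
  cases b
  exacts [rfl, altSum_univ_fin_not false _]

theorem altEulerian_succ (b : Bool) (n : ℕ) :
    altEulerian (n + 1) = ∑ p ∈ Finset.HasAntidiagonal.antidiagonal n, n.choose p.1 *
      ((if b = p.1.bodd then stepWeight p.1 * stepWeight p.2 else 1)
        * (altEulerian p.1 * altEulerian p.2)) := by
  have hinsert := altSum_insert b (m := n) (t := Finset.range n) (by simp)
  have hcount := Finset.sum_powerset_apply_card (x := Finset.range n) fun k =>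
    (if b = k.bodd then stepWeight k * stepWeight (n - k) else 1)
      * (altEulerian k * altEulerian (n - k))
  simp only [altSum_eq_altEulerian, Finset.card_insert_of_notMem Finset.notMem_range_self,
    Finset.card_range] at hinsert hcount
  rw [Finset.Nat.sum_antidiagonal_eq_sum_range_succ_mk, hinsert]
  simp only [← nsmul_eq_mul]
  rw [← hcount]
  refine Finset.sum_congr rfl fun T hT => ?_
  rw [Finset.card_sdiff_of_subset (Finset.mem_powerset.1 hT), Finset.card_range]

theorem altEulerian_zero : altEulerian 0 = 1 := by
  simp [altEulerian, altDes]

theorem two_mul_altEulerian_succ (n : ℕ) :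
    2 * altEulerian (n + 1) =
      ∑ p ∈ Finset.HasAntidiagonal.antidiagonal n,
          n.choose p.1 * (altEulerian p.1 * altEulerian p.2)
        + ∑ p ∈ Finset.HasAntidiagonal.antidiagonal n, n.choose p.1 *
          ((stepWeight p.1 * altEulerian p.1) * (stepWeight p.2 * altEulerian p.2)) := by
  rw [two_mul]
  nth_rewrite 1 [altEulerian_succ false]
  rw [altEulerian_succ true, ← Finset.sum_add_distrib, ← Finset.sum_add_distrib]
  refine Finset.sum_congr rfl fun p _ => ?_
  cases p.1.bodd <;> simp only [if_true, reduceCtorEq, if_false] <;> ring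

end AltSum

section ExponentialGeneratingSeries

variable {R : Type*} [CommRing R] [Algebra ℚ R]

/-- The exponential generating series `∑ aₙ xⁿ / n!` of a sequence. -/
noncomputable def egf (a : ℕ → R) : PowerSeries R :=
  PowerSeries.mk fun n => (n.factorial : ℚ)⁻¹ • a n

theorem factorial_mul_coeff_egf (a : ℕ → R) (n : ℕ) :
    (n.factorial : R) * PowerSeries.coeff n (egf a) = a n := by
  rw [egf, PowerSeries.coeff_mk, ← nsmul_eq_mul, ← Nat.cast_smul_eq_nsmul ℚ,
    smul_inv_smul₀ (by positivity)]

theorem egf_mul_egf (a b : ℕ → R) :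
    egf a * egf b = egf fun n =>
      ∑ p ∈ Finset.HasAntidiagonal.antidiagonal n, n.choose p.1 * (a p.1 * b p.2) := by
  ext n
  simp only [egf, PowerSeries.coeff_mul, PowerSeries.coeff_mk, Finset.smul_sum]
  refine Finset.sum_congr rfl fun p hp => ?_
  obtain rfl := Finset.HasAntidiagonal.mem_antidiagonal.1 hp
  rw [smul_mul_smul_comm, ← nsmul_eq_mul, ← Nat.cast_smul_eq_nsmul ℚ, smul_smul,
    Nat.cast_add_choose]
  congr 1
  field_simp

theorem derivative_egf (a : ℕ → R) :
    PowerSeries.derivative R (egf a) = egf fun n => a (n + 1) := by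
  ext n
  rw [PowerSeries.coeff_derivative, egf, egf, PowerSeries.coeff_mk, PowerSeries.coeff_mk,
    mul_comm, ← Nat.cast_succ, ← nsmul_eq_mul, ← Nat.cast_smul_eq_nsmul ℚ, smul_smul,
    Nat.factorial_succ, Nat.cast_mul]
  congr 1
  field_simp

end ExponentialGeneratingSeries

section StieltjesTable

variable {R : Type*} [CommRing R]

/-- The Stieltjes table of the Jacobi continued fraction with coefficients `g` and `h`. Its entry at
`(n, k)` is the total weight of the Motzkin paths of length `n` from height `0` to height `k`, with
weight `1` for an up step, `g i` for a level step at height `i`, and `h i` for a down step from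
height `i`. The value `h 0` does not occur. -/
def stieltjesTable (g h : ℕ → R) : ℕ → ℕ → R
  | 0, 0 => 1
  | 0, _ + 1 => 0
  | n + 1, 0 => g 0 * stieltjesTable g h n 0 + h 1 * stieltjesTable g h n 1
  | n + 1, k + 1 => stieltjesTable g h n k + g (k + 1) * stieltjesTable g h n (k + 1)
      + h (k + 2) * stieltjesTable g h n (k + 2)

variable {F : PowerSeries R} {a b : R}

theorem derivative_pow_mul_derivative_of_riccati
    (hF : PowerSeries.derivative R F = 1 + PowerSeries.C a * F + PowerSeries.C b * F ^ 2) (k : ℕ) :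
    PowerSeries.derivative R (F ^ k * PowerSeries.derivative R F) =
      k * (F ^ (k - 1) * PowerSeries.derivative R F)
        + (k + 1) * PowerSeries.C a * (F ^ k * PowerSeries.derivative R F)
        + (k + 2) * PowerSeries.C b * (F ^ (k + 1) * PowerSeries.derivative R F) := by
  have hF' := congrArg (PowerSeries.derivative R) hF
  simp only [map_add, Derivation.map_one_eq_zero, Derivation.leibniz, Derivation.leibniz_pow,
    PowerSeries.derivative_C, smul_eq_mul, nsmul_eq_mul, Nat.cast_ofNat, Nat.add_one_sub_one,
    pow_one, mul_zero, add_zero, zero_add] at hF'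
  rw [Derivation.leibniz, Derivation.leibniz_pow, smul_eq_mul, smul_eq_mul, nsmul_eq_mul,
    smul_eq_mul]
  cases k with
  | zero =>
    push_cast
    linear_combination hF'
  | succ k =>
    push_cast
    linear_combination F ^ (k + 1) * hF'
      + (k + 1) * F ^ k * PowerSeries.derivative R F * hF

theorem factorial_mul_coeff_pow_mul_derivative_of_riccati (hF₀ : PowerSeries.constantCoeff F = 0)
    (hF : PowerSeries.derivative R F = 1 + PowerSeries.C a * F + PowerSeries.C b * F ^ 2)
    (n k : ℕ) :
    (n.factorial : R) * PowerSeries.coeff n (F ^ k * PowerSeries.derivative R F) =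
      k.factorial * stieltjesTable (fun k => ((k : R) + 1) * a)
        (fun k => (k : R) * (k + 1) * b) n k := by
  induction n generalizing k with
  | zero => cases k <;> simp [hF, hF₀, stieltjesTable]
  | succ n ih =>
    have hrec := congrArg (PowerSeries.coeff n) (derivative_pow_mul_derivative_of_riccati hF k)
    have hcast : (k : PowerSeries R) = PowerSeries.C (k : R) := by simp
    simp only [PowerSeries.coeff_derivative, map_add, hcast, mul_assoc, add_mul, one_mul, two_mul,
      PowerSeries.coeff_C_mul] at hrec
    have hpred := ih (k - 1)
    have hself := ih k
    have hsucc := ih (k + 1)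
    cases k with
    | zero =>
      simp only [Nat.cast_zero, zero_mul, zero_add, one_mul, Nat.factorial_zero, Nat.cast_one,
        stieltjesTable, Nat.factorial_succ, Nat.cast_mul, Nat.cast_add] at *
      linear_combination (n.factorial : R) * hrec + a * hself + 2 * b * hsucc
    | succ k =>
      simp only [Nat.factorial_succ, Nat.cast_mul, Nat.cast_add, Nat.cast_one, Nat.cast_ofNat,
        Nat.add_one_sub_one, stieltjesTable] at *
      linear_combination (n.factorial : R) * hrec + (k + 1) * hpred + (k + 2) * a * hself
        + (k + 3) * b * hsucc

end StieltjesTable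

section AltEulerianSeries

/-- The exponential generating series of the alternating Eulerian polynomials of positive index. -/
noncomputable def altEulerianSeries : PowerSeries ℝ[X] := egf (Function.update altEulerian 0 0)

theorem constantCoeff_altEulerianSeries : PowerSeries.constantCoeff altEulerianSeries = 0 := by
  simp [altEulerianSeries, egf, ← PowerSeries.coeff_zero_eq_constantCoeff_apply]

theorem derivative_altEulerianSeries :
    PowerSeries.derivative ℝ[X] altEulerianSeries = egf fun n => altEulerian (n + 1) := by
  simp [altEulerianSeries, derivative_egf]

theorem egf_altEulerian : egf altEulerian = 1 + altEulerianSeries := by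
  ext1 n
  cases n <;> simp [altEulerianSeries, egf, PowerSeries.coeff_one, altEulerian_zero]

theorem egf_stepWeight_mul_altEulerian :
    (egf fun n => stepWeight n * altEulerian n) = 1 + PowerSeries.C X * altEulerianSeries := by
  ext1 n
  cases n <;>
    simp [altEulerianSeries, egf, PowerSeries.coeff_one, altEulerian_zero, stepWeight]

theorem two_mul_derivative_altEulerianSeries :
    2 * PowerSeries.derivative ℝ[X] altEulerianSeries =
      (1 + altEulerianSeries) ^ 2 + (1 + PowerSeries.C X * altEulerianSeries) ^ 2 := by
  rw [← egf_altEulerian, ← egf_stepWeight_mul_altEulerian, sq, sq, egf_mul_egf, egf_mul_egf,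
    derivative_altEulerianSeries]
  ext1 n
  simp only [egf, map_add, PowerSeries.coeff_mk, ← smul_add, ← two_mul_altEulerian_succ, two_mul]

theorem riccati_altEulerianSeries :
    PowerSeries.derivative ℝ[X] altEulerianSeries = 1 + PowerSeries.C (X + 1) * altEulerianSeries
      + PowerSeries.C ((X ^ 2 + 1) * C (1 / 2 : ℝ)) * altEulerianSeries ^ 2 := by
  have hhalf : PowerSeries.C (C (1 / 2 : ℝ)) * 2 = 1 := by
    rw [← map_ofNat PowerSeries.C, ← map_ofNat C, ← map_mul, ← map_mul]
    norm_num
  simp only [map_add, map_mul, map_pow, map_one]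
  linear_combination PowerSeries.C (C (1 / 2 : ℝ)) * two_mul_derivative_altEulerianSeries
    - (PowerSeries.derivative ℝ[X] altEulerianSeries - 1
      - (PowerSeries.C X + 1) * altEulerianSeries) * hhalf

theorem altEulerian_succ_eq_stieltjesTable (n : ℕ) :
    altEulerian (n + 1) = stieltjesTable (fun k : ℕ => ((k : ℝ[X]) + 1) * (X + 1))
      (fun k : ℕ => (k : ℝ[X]) * ((k : ℝ[X]) + 1) * ((X ^ 2 + 1) * C (1 / 2 : ℝ))) n 0 := by
  have hcoeff := factorial_mul_coeff_pow_mul_derivative_of_riccati constantCoeff_altEulerianSeries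
    riccati_altEulerianSeries n 0
  rwa [pow_zero, one_mul, derivative_altEulerianSeries, factorial_mul_coeff_egf,
    Nat.factorial_zero, Nat.cast_one, one_mul] at hcoeff

end AltEulerianSeries

section JacobiFraction

variable {R : Type*} [CommRing R]

theorem X_pow_dvd_sub_mul_of_mul_eq_one {N : ℕ} {φ ψ D J : PowerSeries R} (hJ : D * J = 1)
    (hdvd : (PowerSeries.X : PowerSeries R) ^ N ∣ D * φ - ψ) :
    (PowerSeries.X : PowerSeries R) ^ N ∣ φ - J * ψ := by
  have hfactor : φ - J * ψ = J * (D * φ - ψ) := by linear_combination -φ * hJ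
  rw [hfactor]
  exact hdvd.mul_left _

variable (g h : ℕ → R)

/-- The generating series of column `k` of the Stieltjes table. -/
noncomputable def stieltjesColumn (k : ℕ) : PowerSeries R :=
  PowerSeries.mk fun n => stieltjesTable g h n k

theorem stieltjesColumn_zero :
    stieltjesColumn g h 0 = 1 + PowerSeries.X * (PowerSeries.C (g 0) * stieltjesColumn g h 0
      + PowerSeries.C (h 1) * stieltjesColumn g h 1) := by
  ext n
  cases n <;> simp [stieltjesColumn, stieltjesTable, PowerSeries.coeff_one,
    PowerSeries.coeff_succ_X_mul]

theorem stieltjesColumn_succ (k : ℕ) :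
    stieltjesColumn g h (k + 1) = PowerSeries.X * (stieltjesColumn g h k
      + PowerSeries.C (g (k + 1)) * stieltjesColumn g h (k + 1)
      + PowerSeries.C (h (k + 2)) * stieltjesColumn g h (k + 2)) := by
  ext n
  cases n <;> simp [stieltjesColumn, stieltjesTable, PowerSeries.coeff_succ_X_mul]

theorem X_pow_dvd_stieltjesColumn_succ_sub (n k : ℕ) :
    (PowerSeries.X : PowerSeries R) ^ (n + 1) ∣ stieltjesColumn g h (k + 1)
      - jacobiConvergent g h n (k + 1) * (PowerSeries.X * stieltjesColumn g h k) := by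
  induction n generalizing k with
  | zero =>
    apply X_pow_dvd_sub_mul_of_mul_eq_one (jacobiConvergent_zero_mul g h (k + 1))
    refine ⟨PowerSeries.C (h (k + 2)) * stieltjesColumn g h (k + 2), ?_⟩
    linear_combination stieltjesColumn_succ g h k
  | succ n ih =>
    apply X_pow_dvd_sub_mul_of_mul_eq_one (jacobiConvergent_succ_mul g h n (k + 1))
    obtain ⟨ρ, hρ⟩ := ih (k + 1)
    refine ⟨PowerSeries.C (h (k + 2)) * ρ, ?_⟩
    linear_combination stieltjesColumn_succ g h k
      + PowerSeries.X * PowerSeries.C (h (k + 2)) * hρ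

theorem X_pow_dvd_stieltjesColumn_zero_sub (n : ℕ) :
    (PowerSeries.X : PowerSeries R) ^ (n + 1) ∣
      stieltjesColumn g h 0 - jacobiConvergent g h n 0 := by
  rw [← mul_one (jacobiConvergent g h n 0)]
  cases n with
  | zero =>
    apply X_pow_dvd_sub_mul_of_mul_eq_one (jacobiConvergent_zero_mul g h 0)
    refine ⟨PowerSeries.C (h 1) * stieltjesColumn g h 1, ?_⟩
    linear_combination stieltjesColumn_zero g h
  | succ n =>
    apply X_pow_dvd_sub_mul_of_mul_eq_one (jacobiConvergent_succ_mul g h n 0)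
    obtain ⟨ρ, hρ⟩ := X_pow_dvd_stieltjesColumn_succ_sub g h n 0
    refine ⟨PowerSeries.C (h 1) * ρ, ?_⟩
    linear_combination stieltjesColumn_zero g h + PowerSeries.X * PowerSeries.C (h 1) * hρ

theorem hasJacobiFraction_stieltjesColumn : HasJacobiFraction (stieltjesColumn g h 0) g h := by
  intro m
  filter_upwards [Filter.eventually_ge_atTop m] with n hn
  have hcoeff := PowerSeries.X_pow_dvd_iff.1 (X_pow_dvd_stieltjesColumn_zero_sub g h n) m
    (Nat.lt_succ_of_le hn)
  rw [map_sub, sub_eq_zero] at hcoeff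
  exact hcoeff.symm

end JacobiFraction

section TotalPositivity

variable {R : Type*} [CommRing R]

theorem det_mul_eq_sum_minors {n : Type*} [Fintype n] [LinearOrder n] {k : ℕ}
    (A : Matrix (Fin k) n R) (B : Matrix n (Fin k) R) :
    (A * B).det = ∑ p : Fin k ↪o n, (A.submatrix id p).det * (B.submatrix p id).det := by
  have expand : (A * B).det =
      ∑ p : Fin k → n, (∏ i, A i (p i)) * (B.submatrix p id).det := by
    have hrow : A * B = fun i => ∑ l, A i l • B l := by
      ext i c
      simp only [Matrix.mul_apply, Finset.sum_apply, Pi.smul_apply, smul_eq_mul]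
    rw [hrow]
    exact (Matrix.detRowAlternating.toMultilinearMap.map_sum fun i l => A i l • B l).trans <|
      Finset.sum_congr rfl fun p _ => MultilinearMap.map_smul_univ _ _ _
  have sorted (p : Fin k ↪o n) : (A.submatrix id p).det * (B.submatrix p id).det =
      ∑ σ : Equiv.Perm (Fin k), (∏ i, A i (p (σ i))) * (B.submatrix (p ∘ σ) id).det := by
    rw [← Matrix.det_transpose (A.submatrix id p), Matrix.det_apply', Finset.sum_mul]
    refine Finset.sum_congr rfl fun σ _ => ?_
    have hσ := Matrix.det_permute σ (B.submatrix p id)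
    rw [Matrix.submatrix_submatrix, Function.comp_id] at hσ
    rw [hσ]
    simp only [Matrix.transpose_apply, Matrix.submatrix_apply, id_eq]
    ring
  simp_rw [expand, sorted, ← Fintype.sum_prod_type']
  symm
  refine Fintype.sum_of_injective (fun q : (Fin k ↪o n) × Equiv.Perm (Fin k) => q.1 ∘ q.2)
    ?_ _ _ ?_ fun _ => rfl
  · rintro ⟨p, σ⟩ ⟨p', σ'⟩ h
    have hp : p = p' := by
      rw [← OrderEmbedding.range_inj, ← σ.surjective.range_comp p, ← σ'.surjective.range_comp p']
      exact congrArg Set.range h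
    subst hp
    simp only [Prod.mk.injEq, true_and]
    ext i
    exact congrArg Fin.val (p.injective (congrFun h i))
  · intro p hp
    have hinj : ¬ Function.Injective p := fun hinj => hp
      ⟨(OrderEmbedding.ofStrictMono _ ((Tuple.monotone_sort p).strictMono_of_injective
        (hinj.comp (Tuple.sort p).injective)), (Tuple.sort p)⁻¹), by ext i; simp⟩
    obtain ⟨i, j, hij, hne⟩ := Function.not_injective_iff.1 hinj
    rw [Matrix.det_zero_of_row_eq hne (by ext c; simp [hij]), mul_zero]

/-- Total positivity of order `r` relative to a subsemiring `S` of elements regarded as nonnegative: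
all minors of order at most `r` lie in `S`. -/
def IsTotallyPositive {m n : Type*} [Preorder m] [Preorder n] (S : Subsemiring R) (r : ℕ)
    (A : Matrix m n R) : Prop :=
  ∀ k ≤ r, ∀ (i : Fin k ↪o m) (j : Fin k ↪o n), (A.submatrix i j).det ∈ S

namespace IsTotallyPositive

variable {m n l : Type*} {S : Subsemiring R} {r : ℕ}

theorem apply_mem [Preorder m] [Preorder n] {A : Matrix m n R} (hA : IsTotallyPositive S r A)
    (hr : 1 ≤ r) (i : m) (j : n) : A i j ∈ S := by
  simpa using hA 1 hr (OrderEmbedding.ofStrictMono (fun _ => i) (Subsingleton.strictMono _))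
    (OrderEmbedding.ofStrictMono (fun _ => j) (Subsingleton.strictMono _))

theorem transpose [Preorder m] [Preorder n] {A : Matrix m n R} (hA : IsTotallyPositive S r A) :
    IsTotallyPositive S r A.transpose := fun k hk i j => by
  rw [← Matrix.transpose_submatrix, Matrix.det_transpose]
  exact hA k hk j i

theorem submatrix {m' n' : Type*} [Preorder m] [Preorder n] [Preorder m'] [Preorder n']
    {A : Matrix m n R} (hA : IsTotallyPositive S r A) (f : m' ↪o m) (g : n' ↪o n) :
    IsTotallyPositive S r (A.submatrix f g) := fun k hk i j =>
  hA k hk (i.trans f) (j.trans g)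

theorem mul [Preorder m] [LinearOrder n] [Fintype n] [Preorder l] {A : Matrix m n R}
    {B : Matrix n l R} (hA : IsTotallyPositive S r A) (hB : IsTotallyPositive S r B) :
    IsTotallyPositive S r (A * B) := fun k hk i j => by
  rw [← Matrix.submatrix_mul_equiv A B i (Equiv.refl n) j, det_mul_eq_sum_minors]
  exact sum_mem fun p _ => mul_mem (hA k hk i p) (hB k hk p j)

end IsTotallyPositive

theorem det_submatrix_mem_of_card {m n ι : Type*} [Preorder m] [Preorder n] [Fintype ι]
    [LinearOrder ι] {S : Subsemiring R} {A : Matrix m n R}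
    (hA : ∀ (i : Fin (Fintype.card ι) ↪o m) (j : Fin (Fintype.card ι) ↪o n),
      (A.submatrix i j).det ∈ S) (i : ι ↪o m) (j : ι ↪o n) : (A.submatrix i j).det ∈ S := by
  let e := Fintype.orderIsoFinOfCardEq ι rfl
  rw [← Matrix.det_submatrix_equiv_self e.toEquiv]
  exact hA (e.toOrderEmbedding.trans i) (e.toOrderEmbedding.trans j)

section Tridiagonal

variable {A : Matrix ℕ ℕ R} {S : Subsemiring R} {k : ℕ}

theorem det_submatrix_mem_of_gap (hband : ∀ i j, i + 1 < j ∨ j + 1 < i → A i j = 0)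
    (hsmaller : ∀ l < k, ∀ i j : Fin l ↪o ℕ, (A.submatrix i j).det ∈ S) (i j : Fin k ↪o ℕ) {t : ℕ}
    (ht : t + 1 < k) (hgap : i ⟨t, t.lt_succ_self.trans ht⟩ + 1 < j ⟨t + 1, ht⟩ ∨
      j ⟨t, t.lt_succ_self.trans ht⟩ + 1 < i ⟨t + 1, ht⟩) :
    (A.submatrix i j).det ∈ S := by
  have hblock (p : Fin k → Prop) [DecidablePred p] (hp : ∃ s, ¬ p s) :
      ((A.submatrix i j).toSquareBlockProp p).det ∈ S := by
    obtain ⟨s, hs⟩ := hp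
    have hcard : Fintype.card {s // p s} < k := by
      simpa using Fintype.card_subtype_lt hs
    exact det_submatrix_mem_of_card (hsmaller _ hcard)
      ((OrderEmbedding.subtype p).trans i) ((OrderEmbedding.subtype p).trans j)
  let p : Fin k → Prop := fun s => (s : ℕ) ≤ t
  have hp : ∃ s, ¬ p s := ⟨⟨t + 1, ht⟩, by simp [p]⟩
  have hnp : ∃ s, ¬ ¬ p s := ⟨⟨t, by omega⟩, by simp [p]⟩
  have hdet : (A.submatrix i j).det = ((A.submatrix i j).toSquareBlockProp p).det *
      ((A.submatrix i j).toSquareBlockProp fun s => ¬ p s).det := by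
    rcases hgap with hgap | hgap
    · refine Matrix.twoBlockTriangular_det' _ _ fun s hs u hu => hband _ _ (.inl ?_)
      have := i.monotone (show s ≤ ⟨t, by omega⟩ from hs)
      have := j.monotone (show ⟨t + 1, ht⟩ ≤ u from not_le.1 hu)
      omega
    · refine Matrix.twoBlockTriangular_det _ _ fun u hu s hs => hband _ _ (.inr ?_)
      have := j.monotone (show s ≤ ⟨t, by omega⟩ from hs)
      have := i.monotone (show ⟨t + 1, ht⟩ ≤ u from not_le.1 hu)
      omega
  rw [hdet]
  exact mul_mem (hblock p hp) (hblock _ hnp)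

theorem orderEmbeddings_contiguous_of_forall_not_gap (i j : Fin (k + 2) ↪o ℕ)
    (hgap : ∀ t (ht : t + 1 < k + 2),
      j ⟨t + 1, ht⟩ ≤ i ⟨t, t.lt_succ_self.trans ht⟩ + 1 ∧
        i ⟨t + 1, ht⟩ ≤ j ⟨t, t.lt_succ_self.trans ht⟩ + 1) (t : Fin (k + 2)) :
    i t = i 0 + t ∧ j t = i 0 + t := by
  have step (t : ℕ) (ht : t + 1 < k + 2) : i ⟨t, by omega⟩ = j ⟨t, by omega⟩ ∧
      i ⟨t + 1, ht⟩ = i ⟨t, by omega⟩ + 1 ∧ j ⟨t + 1, ht⟩ = j ⟨t, by omega⟩ + 1 := by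
    have := hgap t ht
    have := i.strictMono (show (⟨t, by omega⟩ : Fin (k + 2)) < ⟨t + 1, ht⟩ by simp)
    have := j.strictMono (show (⟨t, by omega⟩ : Fin (k + 2)) < ⟨t + 1, ht⟩ by simp)
    omega
  obtain ⟨t, ht⟩ := t
  induction t with
  | zero => exact ⟨rfl, (step 0 (by omega)).1.symm⟩
  | succ t ih =>
    have := ih (by omega)
    have := step t ht
    dsimp only at *
    omega

/-- Apart from the contiguous principal ones, every minor of order at least two is block triangular
and hence a product of smaller minors. -/
theorem isTotallyPositive_of_tridiagonal {r : ℕ}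
    (hband : ∀ i j, i + 1 < j ∨ j + 1 < i → A i j = 0) (hentry : ∀ i j, A i j ∈ S)
    (hprincipal : ∀ k ≤ r, ∀ m,
      (A.submatrix (fun t : Fin k => m + t) fun t : Fin k => m + t).det ∈ S) :
    IsTotallyPositive S r A := by
  intro k
  induction k using Nat.strong_induction_on with
  | _ k ih =>
  intro hk i j
  by_cases hsplit : ∃ t, ∃ ht : t + 1 < k,
      i ⟨t, t.lt_succ_self.trans ht⟩ + 1 < j ⟨t + 1, ht⟩ ∨
        j ⟨t, t.lt_succ_self.trans ht⟩ + 1 < i ⟨t + 1, ht⟩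
  · obtain ⟨t, ht, hgap⟩ := hsplit
    exact det_submatrix_mem_of_gap hband (fun l hl => ih l hl (hl.le.trans hk)) i j ht hgap
  · push Not at hsplit
    match k with
    | 0 => simp
    | 1 => simpa using hentry (i 0) (j 0)
    | k + 2 =>
      have contiguous := orderEmbeddings_contiguous_of_forall_not_gap i j hsplit
      rw [funext fun t => (contiguous t).2, funext fun t => (contiguous t).1]
      exact hprincipal (k + 2) hk (i 0)

end Tridiagonal

/-- The Krylov matrix of `J` and its bottom unit row vector: row `i` is row `⊥` of `J ^ i`. It is
one of the two factors of the Hankel matrix of `i ↦ (J ^ i) ⊥ ⊥`. -/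
def krylovMatrix {n : Type*} [Fintype n] [DecidableEq n] [LE n] [OrderBot n] (J : Matrix n n R) :
    Matrix ℕ n R :=
  Matrix.of fun i k => (J ^ i) ⊥ k

/-- Cauchy–Binet peels off one factor `J` from all chosen rows at once, until the first of them is
row `0`, which is `(1, 0, 0, …)`. -/
theorem isTotallyPositive_krylovMatrix {n : Type*} [Fintype n] [LinearOrder n] [OrderBot n]
    {J : Matrix n n R} {S : Subsemiring R} {r : ℕ} (hJ : IsTotallyPositive S r J) :
    IsTotallyPositive S r (krylovMatrix J) := by
  intro k hk
  induction k with
  | zero => simp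
  | succ k ih =>
    intro i j
    generalize hm : i 0 = m
    induction m generalizing i j with
    | zero =>
      have hrow (c) (hc : c ≠ 0) : krylovMatrix J (i 0) (j c) = 0 := by
        have : (⊥ : n) ≠ j c := (bot_le.trans_lt (j.strictMono (Fin.pos_of_ne_zero hc))).ne
        simp [krylovMatrix, hm, this]
      have hcorner : krylovMatrix J (i 0) (j 0) ∈ S := by
        simp only [krylovMatrix, hm, pow_zero, Matrix.of_apply, Matrix.one_apply]
        split_ifs
        exacts [one_mem S, zero_mem S]
      rw [Matrix.det_succ_row_zero, Fin.sum_univ_succ, Finset.sum_eq_zero, add_zero]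
      · simpa using mul_mem hcorner (ih (by omega) ((Fin.succOrderEmb k).trans i)
          ((Fin.succOrderEmb k).trans j))
      · intro c _
        simp [hrow]
    | succ m ihm =>
      obtain ⟨i', hi'⟩ : ∃ i' : Fin (k + 1) ↪o ℕ, ∀ t, i t = i' t + 1 := by
        have hpos (t) : 0 < i t := by have := i.monotone (Fin.zero_le t); omega
        refine ⟨OrderEmbedding.ofStrictMono (fun t => i t - 1) fun t u htu => ?_, fun t => ?_⟩
        · have := i.strictMono htu
          have := hpos t
          dsimp only
          omega
        · exact (Nat.sub_add_cancel (hpos t)).symm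
      have hfactor : (krylovMatrix J).submatrix i j =
          (krylovMatrix J).submatrix i' id * J.submatrix id j := by
        ext t c
        simp [krylovMatrix, Matrix.mul_apply, hi', pow_succ]
      rw [hfactor, det_mul_eq_sum_minors]
      exact sum_mem fun p _ => mul_mem (ihm i' p (by have := hi' 0; omega)) (hJ _ hk p j)

/-- The Hankel matrix `(a (i + j))` of the sequence `a`. -/
def hankelMatrix (a : ℕ → R) : Matrix ℕ ℕ R := Matrix.of fun i j => a (i + j)

theorem isTotallyPositive_hankelMatrix_pow {n : Type*} [Fintype n] [LinearOrder n] [OrderBot n]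
    {J : Matrix n n R} {S : Subsemiring R} {r : ℕ} (hJ : IsTotallyPositive S r J) :
    IsTotallyPositive S r (hankelMatrix fun i => (J ^ i) ⊥ ⊥) := by
  have hfactor : hankelMatrix (fun i => (J ^ i) ⊥ ⊥) =
      krylovMatrix J * (krylovMatrix J.transpose).transpose := by
    ext i j
    simp [hankelMatrix, krylovMatrix, pow_add, Matrix.mul_apply, ← Matrix.transpose_pow]
  rw [hfactor]
  exact (isTotallyPositive_krylovMatrix hJ).mul
    (isTotallyPositive_krylovMatrix hJ.transpose).transpose

section Jacobi

/-- The infinite Jacobi matrix: diagonal `g 0, g 1, …`, superdiagonal `1, 1, …` and subdiagonal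
`h 1, h 2, …`; the value `h 0` does not occur. -/
def jacobiMatrix (g h : ℕ → R) : Matrix ℕ ℕ R :=
  Matrix.of fun i j => if j = i then g i else if j = i + 1 then 1 else if i = j + 1 then h i else 0

variable (g h : ℕ → R)

theorem stieltjesTable_eq_zero_of_lt {n k : ℕ} (hnk : n < k) : stieltjesTable g h n k = 0 := by
  obtain ⟨k, rfl⟩ : ∃ l, k = l + 1 := ⟨k - 1, by omega⟩
  induction n generalizing k with
  | zero => rfl
  | succ n ih =>
    obtain ⟨k, rfl⟩ : ∃ l, k = l + 1 := ⟨k - 1, by omega⟩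
    simp only [stieltjesTable, ih _ (show n < k + 1 by omega), ih _ (show n < k + 1 + 1 by omega),
      ih _ (show n < k + 2 + 1 by omega), mul_zero, add_zero]

theorem sum_stieltjesTable_mul_jacobiMatrix {N n k : ℕ} (hn : n ≤ N) (hk : k ≤ N) :
    ∑ l ∈ Finset.range (N + 1), stieltjesTable g h n l * jacobiMatrix g h l k =
      stieltjesTable g h (n + 1) k := by
  have hsplit (l : ℕ) : jacobiMatrix g h l k = (if l = k then g k else 0) +
      (if l = k + 1 then h (k + 1) else 0) + (if l + 1 = k then 1 else 0) := by
    simp only [jacobiMatrix, Matrix.of_apply]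
    grind
  have hlast : (if k + 1 < N + 1 then stieltjesTable g h n (k + 1) * h (k + 1) else 0) =
      stieltjesTable g h n (k + 1) * h (k + 1) := by
    split_ifs with hkN
    · rfl
    · rw [stieltjesTable_eq_zero_of_lt g h (by omega), zero_mul]
  simp only [hsplit, mul_add, mul_ite, mul_one, mul_zero, Finset.sum_add_distrib,
    Finset.sum_ite_eq', Finset.mem_range, Nat.lt_succ_of_le hk, if_true, hlast]
  cases k with
  | zero =>
    simp only [stieltjesTable, Nat.add_one_ne_zero, if_false, Finset.sum_const_zero]
    ring
  | succ k =>
    simp only [stieltjesTable, Nat.add_right_cancel_iff, Finset.sum_ite_eq', Finset.mem_range,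
      if_pos (show k < N + 1 by omega)]
    ring

theorem jacobiMatrix_truncation_pow_zero {N n : ℕ} (hn : n ≤ N) (k : Fin (N + 1)) :
    (((jacobiMatrix g h).submatrix Fin.val Fin.val : Matrix (Fin (N + 1)) _ R) ^ n) 0 k =
      stieltjesTable g h n k := by
  induction n generalizing k with
  | zero =>
    cases k using Fin.cases <;> simp [stieltjesTable, Matrix.one_apply_ne']
  | succ n ih =>
    rw [pow_succ, Matrix.mul_apply,
      ← sum_stieltjesTable_mul_jacobiMatrix g h (by omega : n ≤ N) (by omega : (k : ℕ) ≤ N),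
      Finset.sum_range]
    exact Finset.sum_congr rfl fun l _ => by rw [ih (by omega), Matrix.submatrix_apply]

variable {g h} {S : Subsemiring R} {r : ℕ}

theorem isTotallyPositive_hankelMatrix_stieltjesTable
    (hJ : IsTotallyPositive S r (jacobiMatrix g h)) :
    IsTotallyPositive S r (hankelMatrix fun n => stieltjesTable g h n 0) := by
  intro k hk i j
  obtain ⟨N, hN⟩ : ∃ N, ∀ t u, i t + j u ≤ N := by
    obtain ⟨N, hN⟩ := (Set.finite_range fun p : Fin k × Fin k => i p.1 + j p.2).bddAbove
    exact ⟨N, fun t u => hN ⟨(t, u), rfl⟩⟩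
  have htrunc := isTotallyPositive_hankelMatrix_pow
    (hJ.submatrix (Fin.valOrderEmb (N + 1)) (Fin.valOrderEmb (N + 1))) k hk i j
  convert htrunc using 2
  ext t u
  exact (jacobiMatrix_truncation_pow_zero g h (hN t u) 0).symm

theorem isTotallyPositive_three_jacobiMatrix (hg : ∀ k, g k ∈ S) (hh : ∀ k, h k ∈ S)
    (hminor₂ : ∀ k, g k * g (k + 1) - h (k + 1) ∈ S)
    (hminor₃ : ∀ k, g k * g (k + 1) * g (k + 2) - g k * h (k + 2) - h (k + 1) * g (k + 2) ∈ S) :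
    IsTotallyPositive S 3 (jacobiMatrix g h) := by
  apply isTotallyPositive_of_tridiagonal
  · intro i j hij
    simp only [jacobiMatrix, Matrix.of_apply]
    grind
  · intro i j
    simp only [jacobiMatrix, Matrix.of_apply]
    split_ifs
    exacts [hg i, one_mem S, hh i, zero_mem S]
  · intro k hk m
    interval_cases k
    · simp
    · simpa [jacobiMatrix] using hg m
    · simpa [jacobiMatrix, Matrix.det_fin_two, add_assoc] using hminor₂ m
    · convert hminor₃ m using 1
      simp [jacobiMatrix, Matrix.det_fin_three, add_assoc]

theorem isTotallyPositive_three_jacobiMatrix_of_sq_sub_two_mul_mem {a b : R} (ha : a ∈ S)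
    (hb : b ∈ S) (hab : a ^ 2 - 2 * b ∈ S) :
    IsTotallyPositive S 3
      (jacobiMatrix (fun k => ((k : R) + 1) * a) fun k => (k : R) * (k + 1) * b) := by
  have hk (k : ℕ) : (k : R) ∈ S := natCast_mem S k
  have hsucc (k : ℕ) : (k : R) + 1 ∈ S := add_mem (hk k) (one_mem S)
  refine isTotallyPositive_three_jacobiMatrix (fun k => mul_mem (hsucc k) ha)
    (fun k => mul_mem (mul_mem (hk k) (hsucc k)) hb) (fun k => ?_) fun k => ?_
  · convert mul_mem (mul_mem (hsucc k) (hsucc (k + 1))) (add_mem hab hb) using 1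
    push_cast
    ring
  · convert mul_mem (mul_mem (mul_mem (hsucc k) (hsucc (k + 1))) (hsucc (k + 2)))
      (mul_mem ha hab) using 1
    push_cast
    ring

end Jacobi

end TotalPositivity

theorem mem_lifts_toRealHom_iff {p : ℝ[X]} : p ∈ lifts NNReal.toRealHom ↔ ∀ j, 0 ≤ p.coeff j := by
  simp [lifts_iff_coeff_lifts]

theorem isQLogConvexOrder_two_of_hankelMatrix {f : ℕ → ℝ[X]}
    (hf : IsTotallyPositive (lifts NNReal.toRealHom) 3 (hankelMatrix f)) :
    IsQLogConvexOrder 2 f := by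
  have hterm (i) : f i ∈ lifts NNReal.toRealHom := by
    simpa [hankelMatrix] using hf.apply_mem (by norm_num) i 0
  have hminor {k} (hk : k ≤ 3) (i : ℕ) :=
    hf k hk (Fin.valOrderEmb k |>.trans (OrderEmbedding.addLeft i)) (Fin.valOrderEmb k)
  have hdet₂ (i) : logConvexOp f i =
      ((hankelMatrix f).submatrix (fun t : Fin 2 => i + t) (fun t : Fin 2 => (t : ℕ))).det := by
    simp [logConvexOp, hankelMatrix, Matrix.det_fin_two, sq]
  have hdet₃ (i) : logConvexOp (logConvexOp f) i = f (i + 2) *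
      ((hankelMatrix f).submatrix (fun t : Fin 3 => i + t) (fun t : Fin 3 => (t : ℕ))).det := by
    simp only [logConvexOp, hankelMatrix, Matrix.det_fin_three, Fin.isValue,
      Matrix.submatrix_apply, Fin.coe_ofNat_eq_mod, Nat.zero_mod, add_zero, Matrix.of_apply,
      Nat.one_mod, Nat.mod_succ]
    ring
  intro m hm i
  rw [← mem_lifts_toRealHom_iff]
  interval_cases m
  · exact hterm i
  · rw [Function.iterate_one, hdet₂]
    exact hminor (by norm_num) i
  · rw [Function.iterate_succ, Function.iterate_one, Function.comp_apply, hdet₃]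
    exact mul_mem (hterm _) (hminor le_rfl i)

theorem isTotallyPositive_three_jacobiMatrix_altEulerian :
    IsTotallyPositive (lifts NNReal.toRealHom) 3
      (jacobiMatrix (fun k : ℕ => ((k : ℝ[X]) + 1) * (X + 1))
        fun k : ℕ => (k : ℝ[X]) * ((k : ℝ[X]) + 1) * ((X ^ 2 + 1) * C (1 / 2 : ℝ))) := by
  have hX : (X : ℝ[X]) ∈ lifts NNReal.toRealHom := X_mem_lifts _
  have hhalf : C (1 / 2 : ℝ) ∈ lifts NNReal.toRealHom := by
    simpa using C_mem_lifts NNReal.toRealHom (1 / 2)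
  refine isTotallyPositive_three_jacobiMatrix_of_sq_sub_two_mul_mem (add_mem hX (one_mem _))
    (mul_mem (add_mem (pow_mem hX 2) (one_mem _)) hhalf) ?_
  convert mul_mem (ofNat_mem (lifts NNReal.toRealHom) 2) hX using 1
  have htwo : 2 * C (1 / 2 : ℝ) = 1 := by
    rw [← map_ofNat C, ← map_mul]
    norm_num
  linear_combination -(X ^ 2 + 1) * htwo

theorem proposition4p1 :
    HasJacobiFraction (PowerSeries.mk fun n : ℕ => altEulerian (n + 1))
        (fun i : ℕ => ((i : ℝ[X]) + 1) * (X + 1))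
        (fun i : ℕ => (X ^ 2 + 1) * C ((i : ℝ) * ((i : ℝ) + 1) / 2)) ∧
      IsQLogConvexOrder 2 (fun n : ℕ => altEulerian (n + 1)) := by
  have hweight : (fun i : ℕ => (X ^ 2 + 1) * C ((i : ℝ) * ((i : ℝ) + 1) / 2)) =
      fun i : ℕ => (i : ℝ[X]) * ((i : ℝ[X]) + 1) * ((X ^ 2 + 1) * C (1 / 2 : ℝ)) := by
    funext i
    simp only [map_mul, map_add, map_one, map_natCast, div_eq_mul_inv, one_mul]
    ring
  simp only [hweight, altEulerian_succ_eq_stieltjesTable]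
  exact ⟨hasJacobiFraction_stieltjesColumn _ _,
    isQLogConvexOrder_two_of_hankelMatrix <| isTotallyPositive_hankelMatrix_stieltjesTable
      isTotallyPositive_three_jacobiMatrix_altEulerian⟩
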